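/- Let $\mathbb{K}$ be a field, $V=\mathbb{K}^\ell$ with $\ell\ge 1$, $S=\mathbb{K}[x_1,\ldots,x_\ell]$ with its standard grading, and $\operatorname{Der} S=\bigoplus_{i=1}^{\ell} S\,\partial_{x_i}$, where a derivation $\theta$ is homogeneous of degree $d$ if all $\theta(x_i)$ are homogeneous polynomials of degree $d$. Let $\mathcal{A}$ be a finite set of linear hyperplanes in $V$; for $L\in\mathcal{A}$ let $\alpha_L\in V^*\subset S$ be a non-zero linear form with zero locus $L$. Put $$D(\mathcal{A})=\{\theta\in\operatorname{Der}S \mid \theta(\alpha_L)\in S\alpha_L \text{ for all } L\in\mathcal{A}\}.$$ The arrangement $\mathcal{A}$ is free if $D(\mathcal{A})$ has an $S$-basis of $\ell$ homogeneous derivations. It is SPOG if, for some integers $d_1=1,d_2,\ldots,d_\ell,d\ge 0$, there is a minimal graded free resolution $$0\to S[-d-1]\to \bigoplus_{i=1}^{\ell}S[-d_i]\oplus S[-d]\to D(\mathcal{A})\to 0.$$ If the images of the standard basis of the middle term of such a resolution are $\theta_1,\ldots,\theta_\ell,\varphi$ (so $\deg\theta_i=d_i$ and $\deg\varphi=d$)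 and $\theta_1=\theta_E:=\sum_{i=1}^{\ell} x_i\partial_{x_i}$, then $\theta_E,\theta_2,\ldots,\theta_\ell$ are called SPOG generators and $\varphi$ the corresponding level element. **Proposition.** Let $\mathcal{A}$ be SPOG, $H\in\mathcal{A}$ and $\mathcal{A}'=\mathcal{A}\setminus\{H\}$. If $\mathcal{A}'$ is free, then there are SPOG generators $\theta_1=\theta_E,\theta_2,\ldots,\theta_\ell$ of $\mathcal{A}$ with a level element $\varphi$, and two integers $1<s<t\le\ell$, such that $\theta_s$ and $\theta_t$ are divisible by $\alpha_H$ in $\operatorname{Der}S$ and $$\theta_E,\theta_2,\ldots,\theta_{s-1},\theta_s/\alpha_H,\theta_{s+1},\ldots,\theta_{t-1},\theta_t/\alpha_H,\theta_{t+1},\ldots,\theta_\ell$$ form an $S$-basis of $D(\mathcal{A}')$. -/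

import Mathlib

/-- The coordinate ring `S = K[x_1, …, x_ℓ]` of `V = K^ℓ`. -/
abbrev CoordRing (K : Type*) [Field K] (ℓ : ℕ) : Type _ := MvPolynomial (Fin ℓ) K

/-- The module `Der S` of `K`-linear derivations of `S`; it is `⊕ S ∂_{x_i}`. -/
abbrev Der (K : Type*) [Field K] (ℓ : ℕ) : Type _ :=
  Derivation K (CoordRing K ℓ) (CoordRing K ℓ)

/-- A linear form `α ∈ V^*`, regarded as the element `∑ α(e_i) x_i` of `S`. -/
noncomputable def linPoly {K : Type*} [Field K] {ℓ : ℕ}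
    (α : Module.Dual K (Fin ℓ → K)) : CoordRing K ℓ :=
  ∑ i, MvPolynomial.C (α (Pi.single i 1)) * MvPolynomial.X i

/-- The linear form `α` is a defining form of `H`: it is non-zero and `H` is its zero locus. -/
def Defines {K : Type*} [Field K] {ℓ : ℕ}
    (α : Module.Dual K (Fin ℓ → K)) (H : Submodule K (Fin ℓ → K)) : Prop :=
  α ≠ 0 ∧ LinearMap.ker α = H

/-- A (central) hyperplane arrangement in `V = K^ℓ`: a finite set of linear hyperplanes. -/
structure HypArrangement (K : Type*) [Field K] (ℓ : ℕ) where
  hyperplanes : Set (Submodule K (Fin ℓ → K))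
  finite : hyperplanes.Finite
  isHyperplane : ∀ H ∈ hyperplanes, ∃ α, Defines α H

/-- The Euler derivation `θ_E = ∑ x_i ∂_{x_i}`. -/
noncomputable def eulerDer (K : Type*) [Field K] (ℓ : ℕ) : Der K ℓ :=
  MvPolynomial.mkDerivation K MvPolynomial.X

/-- `θ = ∑ f_i ∂_{x_i}` is homogeneous of degree `d`: every coefficient `f_i = θ(x_i)` is a
homogeneous polynomial of degree `d`. -/
def DerHomogeneous {K : Type*} [Field K] {ℓ : ℕ} (θ : Der K ℓ) (d : ℕ) : Prop :=
  ∀ i, (θ (MvPolynomial.X i)).IsHomogeneous d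

/-- `p`, regarded as an element of the shifted free module `S[-d]`, is homogeneous of
degree `n`; that is, `p` lies in `S_{n-d}`, which is zero when `n < d`. -/
def ShiftHomogeneous {K : Type*} [Field K] {ℓ : ℕ} (p : CoordRing K ℓ) (d n : ℕ) : Prop :=
  p = 0 ∨ ∃ k, k + d = n ∧ p.IsHomogeneous k

/-- The `S`-linear map `S^ℓ ⊕ S → Der S` sending the standard basis to `θ_1, …, θ_ℓ, φ`. -/
noncomputable def genMap {K : Type*} [Field K] {ℓ : ℕ} (θ : Fin ℓ → Der K ℓ) (φ : Der K ℓ) :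
    ((Fin ℓ → CoordRing K ℓ) × CoordRing K ℓ) →ₗ[CoordRing K ℓ] Der K ℓ :=
  (Fintype.linearCombination (CoordRing K ℓ) θ).coprod
    (LinearMap.toSpanSingleton (CoordRing K ℓ) (Der K ℓ) φ)

namespace HypArrangement

/-- The deletion `A \ {H}`. -/
def delete {K : Type*} [Field K] {ℓ : ℕ} (A : HypArrangement K ℓ)
    (H : Submodule K (Fin ℓ → K)) : HypArrangement K ℓ where
  hyperplanes := A.hyperplanes \ {H}
  finite := A.finite.sdiff
  isHyperplane := fun L hL => A.isHyperplane L hL.1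

/-- The logarithmic derivation module `D(A)`. The condition at `H` does not depend on the
choice of the defining form, which is unique up to a non-zero scalar. -/
def logDer {K : Type*} [Field K] {ℓ : ℕ} (A : HypArrangement K ℓ) :
    Submodule (CoordRing K ℓ) (Der K ℓ) where
  carrier := {θ | ∀ H ∈ A.hyperplanes, ∀ α, Defines α H → linPoly α ∣ θ (linPoly α)}
  zero_mem' := fun _ _ _ _ => by simp
  add_mem' := fun ha hb H hH α hα => by
    simpa using dvd_add (ha H hH α hα) (hb H hH α hα)
  smul_mem' := fun c _ ha H hH α hα => by
    simpa using Dvd.dvd.mul_left (ha H hH α hα) c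

/-- `A` is free: `D(A) ≃ ⊕ S[-d_i]` as graded modules, i.e. `D(A)` has an `S`-basis of `ℓ`
homogeneous derivations. -/
def IsFree {K : Type*} [Field K] {ℓ : ℕ} (A : HypArrangement K ℓ) : Prop :=
  ∃ (d : Fin ℓ → ℕ) (b : Module.Basis (Fin ℓ) (CoordRing K ℓ) A.logDer),
    ∀ i, DerHomogeneous (b i : Der K ℓ) (d i)

/-- The maps `ι` and `genMap θ φ` form a minimal graded free resolution
`0 → S[-e-1] → (⊕ S[-d_i]) ⊕ S[-e] → D(A) → 0`. -/
structure IsSPOGResolution {K : Type*} [Field K] {ℓ : ℕ} (A : HypArrangement K ℓ)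
    (d : Fin ℓ → ℕ) (e : ℕ) (θ : Fin ℓ → Der K ℓ) (φ : Der K ℓ)
    (ι : CoordRing K ℓ →ₗ[CoordRing K ℓ] (Fin ℓ → CoordRing K ℓ) × CoordRing K ℓ) :
    Prop where
  /-- The second map is graded. -/
  homogeneous_gen : ∀ i, DerHomogeneous (θ i) (d i)
  homogeneous_level : DerHomogeneous φ e
  /-- The first map is graded: `1`, of degree `e + 1` in `S[-e-1]`, goes to degree `e + 1`. -/
  homogeneous_rel : ∀ i, ShiftHomogeneous ((ι 1).1 i) (d i) (e + 1)
  homogeneous_rel_level : ShiftHomogeneous (ι 1).2 e (e + 1)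
  /-- Exactness of the sequence. -/
  injective : Function.Injective ι
  exact : Function.Exact ι (genMap θ φ)
  range_eq : LinearMap.range (genMap θ φ) = A.logDer
  /-- Minimality: the image of `ι` lies in `𝔪 F` where `𝔪 = (x_1, …, x_ℓ)` and `F` is the
  middle term. -/
  minimal : ∀ p i, MvPolynomial.constantCoeff ((ι p).1 i) = 0
  minimal_level : ∀ p, MvPolynomial.constantCoeff (ι p).2 = 0

/-- `A` is SPOG with `POexp(A) = (1, d_2, …, d_ℓ)` and level `e`
(the index `0 : Fin ℓ` is the first one, so that `d_1 = 1`). -/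
def IsSPOGWith {K : Type*} [Field K] {ℓ : ℕ} [NeZero ℓ] (A : HypArrangement K ℓ)
    (d : Fin ℓ → ℕ) (e : ℕ) : Prop :=
  d 0 = 1 ∧ ∃ θ φ ι, A.IsSPOGResolution d e θ φ ι

/-- `A` is SPOG. -/
def IsSPOG {K : Type*} [Field K] {ℓ : ℕ} [NeZero ℓ] (A : HypArrangement K ℓ) : Prop :=
  ∃ d e, A.IsSPOGWith d e

/-- `θ_1 = θ_E, θ_2, …, θ_ℓ` are SPOG generators of `A`, of degrees `1, d_2, …, d_ℓ`, and `φ`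
is a level element, of degree `e`: they are the generators of `D(A)` given by a minimal free
resolution as in the definition of SPOG. -/
def IsSPOGGenerators {K : Type*} [Field K] {ℓ : ℕ} [NeZero ℓ] (A : HypArrangement K ℓ)
    (d : Fin ℓ → ℕ) (e : ℕ) (θ : Fin ℓ → Der K ℓ) (φ : Der K ℓ) : Prop :=
  d 0 = 1 ∧ θ 0 = eulerDer K ℓ ∧ ∃ ι, A.IsSPOGResolution d e θ φ ι

end HypArrangement

/-!
Let `L = D(A \ {H})` and `M = D(A)`, so that `M` consists of the `θ ∈ L` with `α ∣ θ(α)`. For a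
homogeneous basis `b` of `L` the values `b i (α)` generate an ideal of the domain `S / α`, and `M`
is the module of their syzygies modulo `α`. Choose `b` such that as few of these values as possible
are non-zero modulo `α`, and let `T` be the set of the indices where they are non-zero
(`nonLogIndices`, `IsReducedBasis`). By exchange, the non-zero values generate the ideal minimally,
so the coordinates at `T` of every member of `M` lie in `𝔪 = (x_1, …, x_ℓ)`
(`IsReducedBasis.constantCoeff_eq_zero`).

Hence the `ℓ` derivations `b i` for `i ∉ T` and `α b i` for `i ∈ T` are linearly independent in
`M / 𝔪 M`: the coordinates at `T` of members of `𝔪 M` lie in `𝔪²`, where `α` does not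
(`IsReducedBasis.eq_zero_of_sum_logFactor_smul_eq`). As `M` is SPOG, `M / 𝔪 M` has dimension
`ℓ + 1`, and by the graded Nakayama lemma one more derivation `φ` completes them to a system of
generators of `M` (`exists_generator_completing`, `IsReducedBasis.exists_level`). So the syzygies
modulo `α` of the non-zero values `b i (α)` form a non-zero cyclic module. Its rank is `|T| - 1`,
which forces `|T| = 2` (`IsReducedBasis.card_nonLogIndices_eq_two`). With `T = {s, t}` and
`φ = g_s b_s + g_t b_t`, the only relation between the generators is
`α φ = g_s (α b_s) + g_t (α b_t)`, and this gives the minimal resolution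
(`isSPOGResolution_of_isReducedBasis`).

Finally, `A \ {H}` is not empty, as otherwise the values `b i (α)` would generate the unit ideal.
Therefore `θ_E ∉ 𝔪 L`, and `θ_E` can be exchanged for a member of `b` outside `T`
(`exists_isReducedBasis_eulerDer`).
-/

open MvPolynomial

/-! ### Graded components of polynomials and derivations -/

section Graded

variable {K : Type*} [Field K] {ℓ : ℕ}

/-- The component of degree `n` of `p`, where `p` is regarded as an element of the shifted free
module `S[-d]`: the homogeneous component of `p` of degree `n - d`, which is zero when `n < d`. -/
noncomputable def shiftComp (p : CoordRing K ℓ) (d n : ℕ) : CoordRing K ℓ :=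
  if d ≤ n then homogeneousComponent (n - d) p else 0

theorem shiftComp_isShiftHomogeneous (p : CoordRing K ℓ) (d n : ℕ) :
    ShiftHomogeneous (shiftComp p d n) d n := by
  unfold shiftComp
  split_ifs with h
  · exact Or.inr ⟨n - d, by omega, homogeneousComponent_isHomogeneous _ _⟩
  · exact Or.inl rfl

theorem shiftComp_of_lt (p : CoordRing K ℓ) {d n : ℕ} (h : n < d) : shiftComp p d n = 0 :=
  if_neg (by omega)

theorem shiftComp_self (p : CoordRing K ℓ) (d : ℕ) : shiftComp p d d = C (constantCoeff p) := by
  simp [shiftComp, homogeneousComponent_zero, constantCoeff_eq]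

theorem homogeneousComponent_mul_of_isHomogeneous (p : CoordRing K ℓ) {q : CoordRing K ℓ} {d : ℕ}
    (hq : q.IsHomogeneous d) (n : ℕ) :
    homogeneousComponent n (p * q) = shiftComp p d n * q := by
  let _ := MvPolynomial.gradedAlgebra (σ := Fin ℓ) (R := K)
  have h := DirectSum.coe_decompose_mul_of_right_mem (homogeneousSubmodule (Fin ℓ) K) n
    (a := p) (b := q) (i := d) hq
  have key : ∀ (r : CoordRing K ℓ) (i : ℕ),
      (DirectSum.decompose (homogeneousSubmodule (Fin ℓ) K) r i : CoordRing K ℓ) =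
        homogeneousComponent i r := fun r i => decomposition.decompose'_apply r i
  rw [key, key] at h
  rw [h, shiftComp]
  split_ifs <;> simp

/-- A homogeneous element with non-zero constant term is a non-zero constant. -/
theorem isUnit_shiftComp {p : CoordRing K ℓ} {d n : ℕ}
    (h : constantCoeff (shiftComp p d n) ≠ 0) : IsUnit (shiftComp p d n) := by
  rcases shiftComp_isShiftHomogeneous p d n with h0 | ⟨k, -, hk⟩
  · simp [h0] at h
  · have hk0 : k = 0 := by
      by_contra hne
      exact h (by rw [constantCoeff_eq]; exact hk.coeff_eq_zero (by simpa using Ne.symm hne))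
    subst hk0
    rw [← totalDegree_zero_iff_isHomogeneous, totalDegree_eq_zero_iff_eq_C] at hk
    rw [constantCoeff_eq] at h
    rw [hk]
    exact (isUnit_iff_ne_zero.mpr h).map C

theorem homogeneousComponent_one_mul_eq_zero {p q : CoordRing K ℓ} (hp : constantCoeff p = 0)
    (hq : constantCoeff q = 0) : homogeneousComponent 1 (p * q) = 0 := by
  ext m
  rw [coeff_homogeneousComponent, coeff_zero]
  split_ifs with hm
  · rw [coeff_mul]
    refine Finset.sum_eq_zero fun x hx => ?_
    rw [Finset.HasAntidiagonal.mem_antidiagonal] at hx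
    have hdeg : x.1.degree + x.2.degree = 1 := by rw [← hm, ← hx, map_add]
    rcases (by omega : x.1.degree = 0 ∨ x.2.degree = 0) with h | h
    · rw [Finsupp.degree_eq_zero_iff] at h
      rw [h, ← constantCoeff_eq, hp, zero_mul]
    · rw [Finsupp.degree_eq_zero_iff] at h
      rw [h, ← constantCoeff_eq, hq, mul_zero]
  · rfl

theorem sum_smul_der_apply {J : Type*} [Fintype J] (g : J → CoordRing K ℓ) (G : J → Der K ℓ)
    (p : CoordRing K ℓ) : (∑ j, g j • G j) p = ∑ j, g j * G j p := by
  have h := map_sum (Derivation.coeFnAddMonoidHom (R := K) (A := CoordRing K ℓ)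
    (M := CoordRing K ℓ)) (fun j => g j • G j) Finset.univ
  have h' := congrFun h p
  rw [Finset.sum_apply] at h'
  exact h'

/-- The homogeneous component of degree `n` of a derivation. -/
noncomputable def derComp (n : ℕ) (θ : Der K ℓ) : Der K ℓ :=
  mkDerivation K fun i => homogeneousComponent n (θ (X i))

theorem derComp_of_homogeneous {θ : Der K ℓ} {n : ℕ} (h : DerHomogeneous θ n) :
    derComp n θ = θ :=
  derivation_ext fun i => by
    rw [derComp, mkDerivation_X, homogeneousComponent_of_mem (h i), if_pos rfl]

theorem derComp_sum_smul {J : Type*} [Fintype J] (g : J → CoordRing K ℓ) {G : J → Der K ℓ}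
    {δ : J → ℕ} (hG : ∀ j, DerHomogeneous (G j) (δ j)) (n : ℕ) :
    derComp n (∑ j, g j • G j) = ∑ j, shiftComp (g j) (δ j) n • G j :=
  derivation_ext fun i => by
    rw [derComp, mkDerivation_X, sum_smul_der_apply, sum_smul_der_apply, map_sum]
    exact Finset.sum_congr rfl fun j _ =>
      homogeneousComponent_mul_of_isHomogeneous _ (hG j i) n

theorem DerHomogeneous.smul {θ : Der K ℓ} {n m : ℕ} (h : DerHomogeneous θ n)
    {p : CoordRing K ℓ} (hp : p.IsHomogeneous m) : DerHomogeneous (p • θ) (n + m) := fun i => by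
  rw [add_comm]
  exact hp.mul (h i)

theorem derHomogeneous_derComp (n : ℕ) (θ : Der K ℓ) : DerHomogeneous (derComp n θ) n := fun i => by
  rw [derComp, mkDerivation_X]
  exact homogeneousComponent_isHomogeneous _ _

end Graded

/-! ### Linear forms -/

section LinearForms

variable {K : Type*} [Field K] {ℓ : ℕ}

theorem linPoly_isHomogeneous (α : Module.Dual K (Fin ℓ → K)) : (linPoly α).IsHomogeneous 1 :=
  IsHomogeneous.sum _ _ _ fun i _ => isHomogeneous_C_mul_X _ i

theorem constantCoeff_linPoly (α : Module.Dual K (Fin ℓ → K)) :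
    constantCoeff (linPoly α) = 0 := by
  simp [linPoly]

theorem linPoly_smul (c : K) (α : Module.Dual K (Fin ℓ → K)) :
    linPoly (c • α) = C c * linPoly α := by
  simp [linPoly, Finset.mul_sum, mul_assoc]

theorem exists_single_ne_zero {α : Module.Dual K (Fin ℓ → K)} (h : α ≠ 0) :
    ∃ i, α (Pi.single i 1) ≠ 0 := by
  by_contra! hc
  refine h (LinearMap.pi_ext' fun i => LinearMap.ext_ring ?_)
  simpa using hc i

theorem coeff_linPoly (α : Module.Dual K (Fin ℓ → K)) (i : Fin ℓ) :
    (linPoly α).coeff (Finsupp.single i 1) = α (Pi.single i 1) := by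
  classical
  simp only [linPoly, coeff_sum, coeff_C_mul, coeff_X]
  rw [Finset.sum_eq_single i]
  · simp
  · intro j _ hj
    simp [Finsupp.single_left_inj, hj]
  · simp

theorem linPoly_ne_zero {α : Module.Dual K (Fin ℓ → K)} (h : α ≠ 0) : linPoly α ≠ 0 := by
  obtain ⟨i, hi⟩ := exists_single_ne_zero h
  intro h0
  exact hi (by rw [← coeff_linPoly, h0, coeff_zero])

theorem linPoly_prime {α : Module.Dual K (Fin ℓ → K)} (h : α ≠ 0) : Prime (linPoly α) := by
  obtain ⟨i, hi⟩ := exists_single_ne_zero h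
  refine (irreducible_of_totalDegree_eq_one
    ((linPoly_isHomogeneous α).totalDegree (linPoly_ne_zero h)) fun x hx => ?_).prime
  have := hx (Finsupp.single i 1)
  rw [coeff_linPoly] at this
  exact isUnit_of_dvd_unit this (isUnit_iff_ne_zero.mpr hi)

theorem Defines.exists_smul_eq {α β : Module.Dual K (Fin ℓ → K)}
    {H : Submodule K (Fin ℓ → K)} (hα : Defines α H) (hβ : Defines β H) :
    ∃ c : K, c ≠ 0 ∧ β = c • α := by
  have h := mem_span_of_iInf_ker_le_ker (ι := Unit) (L := fun _ => α) (K := β)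
    (by simp [hα.2, hβ.2])
  rw [Set.range_const, Submodule.mem_span_singleton] at h
  obtain ⟨c, hc⟩ := h
  exact ⟨c, fun h0 => hβ.1 (by rw [← hc, h0, zero_smul]), hc.symm⟩

theorem DerHomogeneous.apply_linPoly {θ : Der K ℓ} {n : ℕ} (h : DerHomogeneous θ n)
    (α : Module.Dual K (Fin ℓ → K)) : (θ (linPoly α)).IsHomogeneous n := by
  rw [linPoly, map_sum]
  refine IsHomogeneous.sum _ _ _ fun i _ => ?_
  rw [Derivation.leibniz, derivation_C, smul_zero, add_zero, smul_eq_mul]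
  exact (h i).C_mul _

theorem eulerDer_linPoly (α : Module.Dual K (Fin ℓ → K)) :
    eulerDer K ℓ (linPoly α) = linPoly α := by
  simp [eulerDer, linPoly, mkDerivation_X]

theorem derHomogeneous_eulerDer : DerHomogeneous (eulerDer K ℓ) 1 := fun i => by
  rw [eulerDer, mkDerivation_X]
  exact isHomogeneous_X _ _

end LinearForms

namespace HypArrangement

variable {K : Type*} [Field K] {ℓ : ℕ}

theorem eulerDer_mem_logDer (A : HypArrangement K ℓ) : eulerDer K ℓ ∈ A.logDer :=
  fun _ _ α _ => by rw [eulerDer_linPoly]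

theorem mem_logDer_iff_delete (A : HypArrangement K ℓ) {H : Submodule K (Fin ℓ → K)}
    (hH : H ∈ A.hyperplanes) {α : Module.Dual K (Fin ℓ → K)} (hα : Defines α H) (θ : Der K ℓ) :
    θ ∈ A.logDer ↔ θ ∈ (A.delete H).logDer ∧ linPoly α ∣ θ (linPoly α) := by
  constructor
  · exact fun h => ⟨fun L hL => h L hL.1, h H hH α hα⟩
  · rintro ⟨h, h'⟩ L hL β hβ
    by_cases hLH : L = H
    · subst hLH
      obtain ⟨c, hc, rfl⟩ := hα.exists_smul_eq hβ
      rw [linPoly_smul, Derivation.leibniz, derivation_C, smul_zero, add_zero, smul_eq_mul]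
      exact mul_dvd_mul_left _ h'
    · exact h L ⟨hL, hLH⟩ β hβ

end HypArrangement

/-! ### Homogeneous bases and exchange -/

section HomogeneousBases

variable {K : Type*} [Field K] {ℓ : ℕ}

/-- The derivations `b i`, homogeneous of degrees `d i`, form an `S`-basis of the submodule `L`
of `Der S`. The rank is `ℓ`, as it is for every free logarithmic derivation module. -/
structure IsHomogeneousBasis (L : Submodule (CoordRing K ℓ) (Der K ℓ)) (b : Fin ℓ → Der K ℓ)
    (d : Fin ℓ → ℕ) : Prop where
  linearIndependent : LinearIndependent (CoordRing K ℓ) b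
  span_eq : Submodule.span (CoordRing K ℓ) (Set.range b) = L
  homogeneous : ∀ i, DerHomogeneous (b i) (d i)

namespace IsHomogeneousBasis

variable {L : Submodule (CoordRing K ℓ) (Der K ℓ)} {b : Fin ℓ → Der K ℓ} {d : Fin ℓ → ℕ}

theorem mem (hb : IsHomogeneousBasis L b d) (i : Fin ℓ) : b i ∈ L :=
  hb.span_eq ▸ Submodule.subset_span ⟨i, rfl⟩

theorem exists_coeffs (hb : IsHomogeneousBasis L b d) {θ : Der K ℓ} (h : θ ∈ L) :
    ∃ g : Fin ℓ → CoordRing K ℓ, ∑ j, g j • b j = θ := by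
  rw [← hb.span_eq] at h
  exact (Submodule.mem_span_range_iff_exists_fun _).mp h

theorem sum_mem (hb : IsHomogeneousBasis L b d) (g : Fin ℓ → CoordRing K ℓ) :
    ∑ j, g j • b j ∈ L :=
  Submodule.sum_mem _ fun j _ => Submodule.smul_mem _ _ (hb.mem j)

theorem coeffs_ext (hb : IsHomogeneousBasis L b d) {g h : Fin ℓ → CoordRing K ℓ}
    (e : ∑ j, g j • b j = ∑ j, h j • b j) (i : Fin ℓ) : g i = h i := by
  have := Fintype.linearIndependent_iff.mp hb.linearIndependent (fun j => g j - h j)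
    (by simp only [sub_smul, Finset.sum_sub_distrib, e, sub_self]) i
  exact sub_eq_zero.mp this

/-- The coordinates of a homogeneous derivation are homogeneous. -/
theorem shiftComp_coeff (hb : IsHomogeneousBasis L b d) {g : Fin ℓ → CoordRing K ℓ} {n : ℕ}
    (h : DerHomogeneous (∑ j, g j • b j) n) (i : Fin ℓ) : shiftComp (g i) (d i) n = g i :=
  hb.coeffs_ext (g := fun j => shiftComp (g j) (d j) n)
    (by rw [← derComp_sum_smul g hb.homogeneous, derComp_of_homogeneous h]) i

/-- Exchange: a member of a homogeneous basis may be replaced by a homogeneous derivation in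
which it occurs with a unit coefficient. -/
theorem update (hb : IsHomogeneousBasis L b d) {p : Fin ℓ → CoordRing K ℓ} {i : Fin ℓ}
    (hp : IsUnit (p i)) {n : ℕ} (hv : DerHomogeneous (∑ j, p j • b j) n) :
    IsHomogeneousBasis L (Function.update b i (∑ j, p j • b j)) (Function.update d i n) where
  linearIndependent :=
    hb.linearIndependent.update i _ ⟨1, one_mem _, Finsupp.equivFunOnFinite.symm p,
      hp.mem_nonZeroDivisors, by
        simp [Finsupp.linearCombination_apply, Finsupp.sum_fintype]⟩
  span_eq := by
    apply le_antisymm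
    · rw [Submodule.span_le]
      rintro _ ⟨j, rfl⟩
      by_cases hj : j = i
      · subst hj
        rw [Function.update_self]
        exact hb.sum_mem p
      · rw [Function.update_of_ne hj]
        exact hb.mem j
    · set W := Submodule.span (CoordRing K ℓ)
        (Set.range (Function.update b i (∑ j, p j • b j))) with hW
      have hne : ∀ j, j ≠ i → b j ∈ W := fun j hj =>
        Submodule.subset_span ⟨j, Function.update_of_ne hj _ _⟩
      have hself : ∑ j, p j • b j ∈ W :=
        Submodule.subset_span ⟨i, Function.update_self _ _ _⟩
      have hi : b i ∈ W := by
        rw [← Finset.add_sum_erase _ _ (Finset.mem_univ i)] at hself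
        have h1 : p i • b i ∈ W := (Submodule.add_mem_iff_left W
          (Submodule.sum_mem _ fun j hj =>
            Submodule.smul_mem _ _ (hne j (Finset.ne_of_mem_erase hj)))).mp hself
        obtain ⟨u, hu⟩ := hp
        rw [← hu] at h1
        simpa [smul_smul] using Submodule.smul_mem W ((u⁻¹ : (CoordRing K ℓ)ˣ) : CoordRing K ℓ) h1
      rw [← hb.span_eq, Submodule.span_le]
      rintro _ ⟨j, rfl⟩
      by_cases hj : j = i
      · exact hj ▸ hi
      · exact hne j hj
  homogeneous := fun j => by
    by_cases hj : j = i
    · subst hj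
      simpa using hv
    · simpa [hj] using hb.homogeneous j

theorem reindex (hb : IsHomogeneousBasis L b d) (σ : Equiv.Perm (Fin ℓ)) :
    IsHomogeneousBasis L (b ∘ σ) (d ∘ σ) where
  linearIndependent := hb.linearIndependent.comp σ σ.injective
  span_eq := by rw [σ.surjective.range_comp, hb.span_eq]
  homogeneous := fun i => hb.homogeneous (σ i)

end IsHomogeneousBasis

open scoped Classical in
/-- The indices `i` for which `b i` is not logarithmic along the hyperplane `α = 0`. -/
noncomputable def nonLogIndices (α : Module.Dual K (Fin ℓ → K)) (b : Fin ℓ → Der K ℓ) :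
    Finset (Fin ℓ) :=
  Finset.univ.filter fun i => ¬ linPoly α ∣ b i (linPoly α)

theorem mem_nonLogIndices {α : Module.Dual K (Fin ℓ → K)} {b : Fin ℓ → Der K ℓ} {i : Fin ℓ} :
    i ∈ nonLogIndices α b ↔ ¬ linPoly α ∣ b i (linPoly α) := by
  simp [nonLogIndices]

/-- A homogeneous basis of `L` with the least possible number of members that are not
logarithmic along `α = 0`. The values at `α` of these members, taken modulo `α`, then generate
minimally the ideal `{θ(α) | θ ∈ L}` of `S / α`. -/
structure IsReducedBasis (α : Module.Dual K (Fin ℓ → K))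
    (L : Submodule (CoordRing K ℓ) (Der K ℓ)) (b : Fin ℓ → Der K ℓ) (d : Fin ℓ → ℕ) : Prop
    extends IsHomogeneousBasis L b d where
  card_le : ∀ b' d', IsHomogeneousBasis L b' d' →
    (nonLogIndices α b).card ≤ (nonLogIndices α b').card

theorem IsHomogeneousBasis.exists_isReducedBasis (α : Module.Dual K (Fin ℓ → K))
    {L : Submodule (CoordRing K ℓ) (Der K ℓ)} {b : Fin ℓ → Der K ℓ} {d : Fin ℓ → ℕ}
    (hb : IsHomogeneousBasis L b d) : ∃ b' d', IsReducedBasis α L b' d' := by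
  classical
  have hex : ∃ n, ∃ b' d', IsHomogeneousBasis L b' d' ∧ (nonLogIndices α b').card = n :=
    ⟨_, b, d, hb, rfl⟩
  obtain ⟨b', d', h, hc⟩ := Nat.find_spec hex
  exact ⟨b', d', h, fun b'' d'' h' => hc ▸ Nat.find_min' hex ⟨b'', d'', h', rfl⟩⟩

namespace IsReducedBasis

variable {α : Module.Dual K (Fin ℓ → K)} {L : Submodule (CoordRing K ℓ) (Der K ℓ)}
  {b : Fin ℓ → Der K ℓ} {d : Fin ℓ → ℕ}

/-- If a derivation in `L` is logarithmic along `α = 0`, then its coordinates at the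
non-logarithmic members of a reduced basis have no constant term: otherwise one of those members
could be exchanged for a homogeneous component of the derivation. -/
theorem constantCoeff_eq_zero (hb : IsReducedBasis α L b d) {g : Fin ℓ → CoordRing K ℓ}
    (hg : linPoly α ∣ (∑ j, g j • b j) (linPoly α)) {i : Fin ℓ} (hi : i ∈ nonLogIndices α b) :
    constantCoeff (g i) = 0 := by
  by_contra hne
  let p : Fin ℓ → CoordRing K ℓ := fun j => shiftComp (g j) (d j) (d i)
  have hcomp : ∑ j, p j • b j = derComp (d i) (∑ j, g j • b j) :=
    (derComp_sum_smul g hb.homogeneous _).symm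
  have hu : IsUnit (p i) := isUnit_shiftComp (by simpa [shiftComp_self] using hne)
  have hdvd : linPoly α ∣ (∑ j, p j • b j) (linPoly α) := by
    have h1 : (∑ j, p j • b j) (linPoly α) =
        homogeneousComponent (d i) ((∑ j, g j • b j) (linPoly α)) := by
      rw [sum_smul_der_apply, sum_smul_der_apply, map_sum]
      exact Finset.sum_congr rfl fun j _ => (homogeneousComponent_mul_of_isHomogeneous _
        ((hb.homogeneous j).apply_linPoly α) _).symm
    obtain ⟨q, hq⟩ := hg
    rw [h1, hq, mul_comm,
      homogeneousComponent_mul_of_isHomogeneous _ (linPoly_isHomogeneous α)]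
    exact dvd_mul_left _ _
  have hnew := hb.update hu (n := d i) (hcomp ▸ derHomogeneous_derComp _ _)
  refine (hb.card_le _ _ hnew).not_gt (Finset.card_lt_card ?_)
  refine Finset.ssubset_iff_subset_ne.mpr ⟨fun j hj => ?_, fun h => ?_⟩
  · rw [mem_nonLogIndices] at hj ⊢
    by_cases hji : j = i
    · subst hji
      exact absurd hdvd (by simpa using hj)
    · simpa [hji] using hj
  · rw [← h, mem_nonLogIndices] at hi
    exact hi (by simpa using hdvd)

/-- Exchanging a member for a logarithmic derivation keeps a basis reduced. -/
theorem update (hb : IsReducedBasis α L b d) {p : Fin ℓ → CoordRing K ℓ} {i : Fin ℓ}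
    (hp : IsUnit (p i)) {n : ℕ} (hv : DerHomogeneous (∑ j, p j • b j) n)
    (hdvd : linPoly α ∣ (∑ j, p j • b j) (linPoly α)) :
    IsReducedBasis α L (Function.update b i (∑ j, p j • b j)) (Function.update d i n) where
  toIsHomogeneousBasis := hb.toIsHomogeneousBasis.update hp hv
  card_le := fun b' d' h => by
    refine (Finset.card_le_card fun j hj => ?_).trans (hb.card_le b' d' h)
    rw [mem_nonLogIndices] at hj ⊢
    by_cases hji : j = i
    · subst hji
      exact absurd hdvd (by simpa using hj)
    · simpa [hji] using hj

theorem reindex (hb : IsReducedBasis α L b d) (σ : Equiv.Perm (Fin ℓ)) :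
    IsReducedBasis α L (b ∘ σ) (d ∘ σ) where
  toIsHomogeneousBasis := hb.toIsHomogeneousBasis.reindex σ
  card_le := fun b' d' h => by
    refine (Finset.card_le_card_of_injOn σ (fun j hj => ?_) σ.injective.injOn).trans
      (hb.card_le b' d' h)
    simpa [mem_nonLogIndices] using hj

end IsReducedBasis

end HomogeneousBases

/-! ### Minimal generators of graded modules of derivations -/

section MinimalGenerators

variable {K : Type*} [Field K] {ℓ : ℕ}

/-- Graded Nakayama lemma: if the homogeneous derivations `G k` are congruent to elements of
the span of the homogeneous derivations `N i` modulo `𝔪 = (x_1, …, x_ℓ)` times the span of the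
`G k`, then they lie in the span of the `N i`. -/
theorem mem_span_of_congruent {I J : Type*} [Fintype I] [Fintype J] {N : I → Der K ℓ}
    {ν : I → ℕ} (hN : ∀ i, DerHomogeneous (N i) (ν i)) {G : J → Der K ℓ} {δ : J → ℕ}
    (hG : ∀ j, DerHomogeneous (G j) (δ j))
    (h : ∀ k, ∃ (c : I → CoordRing K ℓ) (q : J → CoordRing K ℓ),
      (∀ j, constantCoeff (q j) = 0) ∧ G k = ∑ i, c i • N i + ∑ j, q j • G j) (k : J) :
    G k ∈ Submodule.span (CoordRing K ℓ) (Set.range N) := by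
  induction hn : δ k using Nat.strong_induction_on generalizing k with
  | _ n ih =>
    subst hn
    obtain ⟨c, q, hq, he⟩ := h k
    have he' : ∑ i, c i • N i + ∑ j, q j • G j =
        ∑ x : I ⊕ J, Sum.elim c q x • Sum.elim N G x := by
      simp [Fintype.sum_sum_type]
    have hNG : ∀ x : I ⊕ J, DerHomogeneous (Sum.elim N G x) (Sum.elim ν δ x) := by
      rintro (i | j)
      exacts [hN i, hG j]
    rw [← derComp_of_homogeneous (hG k), he, he', derComp_sum_smul _ hNG]
    refine Submodule.sum_mem _ ?_
    rintro (i | j) -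
    · exact Submodule.smul_mem _ _ (Submodule.subset_span ⟨i, rfl⟩)
    · rcases lt_trichotomy (δ j) (δ k) with hlt | heq | hgt
      · exact Submodule.smul_mem _ _ (ih _ hlt j rfl)
      · simp [heq, shiftComp_self, hq]
      · simp [shiftComp_of_lt _ hgt]

/-- Let the homogeneous derivations `G j` be minimal generators. If the homogeneous derivations
`N i` in their span are linearly independent modulo `𝔪` times this span, and are one fewer in
number, then one of the `G j`, not in the span of the `N i`, generates the span of the `G j`
together with them. -/
theorem exists_generator_completing {I J : Type*} [Fintype I] [Fintype J] {N : I → Der K ℓ}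
    {ν : I → ℕ} (hN : ∀ i, DerHomogeneous (N i) (ν i)) {G : J → Der K ℓ} {δ : J → ℕ}
    (hG : ∀ j, DerHomogeneous (G j) (δ j)) (hcard : Fintype.card J = Fintype.card I + 1)
    (hmin : ∀ p : J → CoordRing K ℓ, ∑ j, p j • G j = 0 → ∀ j, constantCoeff (p j) = 0)
    (hNG : ∀ i, N i ∈ Submodule.span (CoordRing K ℓ) (Set.range G))
    (hind : ∀ (c : I → K) (q : J → CoordRing K ℓ), (∀ j, constantCoeff (q j) = 0) →
      ∑ i, (C (c i) : CoordRing K ℓ) • N i = ∑ j, q j • G j → ∀ i, c i = 0) :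
    ∃ j, G j ∉ Submodule.span (CoordRing K ℓ) (Set.range N) ∧
      Submodule.span (CoordRing K ℓ) (Set.range G) =
        Submodule.span (CoordRing K ℓ) (Set.range N) ⊔
          Submodule.span (CoordRing K ℓ) {G j} := by
  classical
  let Φ : (J → CoordRing K ℓ) →ₗ[CoordRing K ℓ] Der K ℓ :=
    Fintype.linearCombination (CoordRing K ℓ) G
  have hΦ : ∀ p, Φ p = ∑ j, p j • G j := fun p => Fintype.linearCombination_apply _ _ _
  have hΦs : ∀ k, Φ (Pi.single k 1) = G k := fun k =>
    (Fintype.linearCombination_apply_single _ _ _ _).trans (one_smul _ _)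
  have hx' : ∀ i, ∃ x, Φ x = N i := fun i =>
    (Submodule.mem_span_range_iff_exists_fun _).mp (hNG i)
  choose x hx using hx'
  have hs : ∀ m l : J, constantCoeff ((Pi.single m 1 : J → CoordRing K ℓ) l) =
      (Pi.single m 1 : J → K) l := fun m l => by
    by_cases hlm : l = m
    · subst hlm; simp
    · simp [hlm]
  -- The coordinates of the `N i` in the `K`-vector space obtained by reducing modulo `𝔪`.
  let w : I → J → K := fun i j => constantCoeff (x i j)
  have hw : LinearIndependent K w := by
    rw [Fintype.linearIndependent_iff]
    intro c hc
    refine hind c (∑ i, (C (c i) : CoordRing K ℓ) • x i) (fun j => ?_) ?_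
    · have := congrFun hc j
      simpa [w, Finset.sum_apply] using this
    · rw [← hΦ, map_sum]
      exact Finset.sum_congr rfl fun i _ => by rw [map_smul, hx]
  obtain ⟨j, hj⟩ : ∃ j, (Pi.single j 1 : J → K) ∉ Submodule.span K (Set.range w) := by
    by_contra! hall
    have htop : Submodule.span K (Set.range w) = ⊤ := by
      rw [eq_top_iff, ← (Pi.basisFun K J).span_eq, Submodule.span_le]
      rintro _ ⟨j, rfl⟩
      simpa using hall j
    have h1 := finrank_span_eq_card hw
    rw [htop, finrank_top, Module.finrank_fintype_fun_eq_card] at h1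
    omega
  refine ⟨j, fun hmem => ?_, le_antisymm ?_ ?_⟩
  · obtain ⟨a, ha⟩ := (Submodule.mem_span_range_iff_exists_fun _).mp hmem
    have hrel : Φ (∑ i, a i • x i - Pi.single j 1) = 0 := by
      rw [map_sub, map_sum, hΦs, ← ha, sub_eq_zero]
      exact Finset.sum_congr rfl fun i _ => by rw [map_smul, hx]
    refine hj ((Submodule.mem_span_range_iff_exists_fun _).mpr
      ⟨fun i => constantCoeff (a i), funext fun k => ?_⟩)
    have := hmin _ (by rw [← hΦ]; exact hrel) k
    rw [Pi.sub_apply, map_sub, sub_eq_zero, hs] at this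
    rw [← this]
    simp [w, Finset.sum_apply]
  · have hW : LinearIndependent K (fun o : Option I => Option.casesOn' o (Pi.single j 1) w) :=
      linearIndependent_option'.mpr ⟨hw, hj⟩
    have htop := hW.span_eq_top_of_card_eq_finrank' (by simp [hcard])
    let NN : Option I → Der K ℓ := fun o => o.elim (G j) N
    have hNN : ∀ o, DerHomogeneous (NN o) (o.elim (δ j) ν) := by
      rintro (_ | i)
      exacts [hG j, hN i]
    have key := mem_span_of_congruent hNN hG fun k => by
      have hk : (Pi.single k 1 : J → K) ∈ (⊤ : Submodule K (J → K)) := trivial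
      rw [← htop] at hk
      obtain ⟨c, hc⟩ := (Submodule.mem_span_range_iff_exists_fun _).mp hk
      refine ⟨fun o => C (c o), Pi.single k 1 - ((C (c none) : CoordRing K ℓ) • Pi.single j 1 +
        ∑ i, (C (c (some i)) : CoordRing K ℓ) • x i), fun l => ?_, ?_⟩
      · have hl := congrFun hc l
        simp only [Fintype.sum_option, Pi.smul_apply, Finset.sum_apply,
          Option.casesOn', smul_eq_mul] at hl
        rw [Pi.sub_apply, map_sub, hs, ← hl, sub_eq_zero]
        simp [w, Finset.sum_apply, hs]
      · rw [← hΦ, map_sub, map_add, map_smul, map_sum, hΦs, hΦs, Fintype.sum_option,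
          Finset.sum_congr rfl fun i _ => (by rw [map_smul, hx] :
            Φ ((C (c (some i)) : CoordRing K ℓ) • x i) = (C (c (some i)) : CoordRing K ℓ) • N i)]
        exact (add_sub_cancel _ _).symm
    rw [Submodule.span_le]
    rintro _ ⟨k, rfl⟩
    refine Submodule.span_le.mpr ?_ (key k)
    rintro _ ⟨_ | i, rfl⟩
    · exact Submodule.mem_sup_right (Submodule.mem_span_singleton_self _)
    · exact Submodule.mem_sup_left (Submodule.subset_span ⟨i, rfl⟩)
  · refine sup_le (Submodule.span_le.mpr ?_) (Submodule.span_le.mpr ?_)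
    · rintro _ ⟨i, rfl⟩
      exact hNG i
    · rw [Set.singleton_subset_iff]
      exact Submodule.subset_span ⟨j, rfl⟩

end MinimalGenerators

/-! ### The level element and the number of non-logarithmic basis members -/

section LevelElement

variable {K : Type*} [Field K] {ℓ : ℕ}

/-- The factor `α` at the indices in `nonLogIndices α b`, and `1` elsewhere: multiplying `b i` by
it makes `b i` logarithmic along `α = 0`. -/
noncomputable def logFactor (α : Module.Dual K (Fin ℓ → K)) (b : Fin ℓ → Der K ℓ) (i : Fin ℓ) :
    CoordRing K ℓ :=
  if i ∈ nonLogIndices α b then linPoly α else 1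

theorem logFactor_of_mem {α : Module.Dual K (Fin ℓ → K)} {b : Fin ℓ → Der K ℓ} {i : Fin ℓ}
    (h : i ∈ nonLogIndices α b) : logFactor α b i = linPoly α := if_pos h

theorem logFactor_of_notMem {α : Module.Dual K (Fin ℓ → K)} {b : Fin ℓ → Der K ℓ} {i : Fin ℓ}
    (h : i ∉ nonLogIndices α b) : logFactor α b i = 1 := if_neg h

theorem logFactor_isHomogeneous (α : Module.Dual K (Fin ℓ → K)) (b : Fin ℓ → Der K ℓ)
    (i : Fin ℓ) :
    (logFactor α b i).IsHomogeneous (if i ∈ nonLogIndices α b then 1 else 0) := by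
  unfold logFactor
  split_ifs
  · exact linPoly_isHomogeneous α
  · exact isHomogeneous_one _ _

theorem IsHomogeneousBasis.sum_smul_mem_span_logFactor_smul_iff {α : Module.Dual K (Fin ℓ → K)}
    {L : Submodule (CoordRing K ℓ) (Der K ℓ)} {b : Fin ℓ → Der K ℓ} {d : Fin ℓ → ℕ}
    (hb : IsHomogeneousBasis L b d) (g : Fin ℓ → CoordRing K ℓ) :
    ∑ i, g i • b i ∈ Submodule.span (CoordRing K ℓ)
      (Set.range fun i => logFactor α b i • b i) ↔ ∀ i ∈ nonLogIndices α b, linPoly α ∣ g i := by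
  rw [Submodule.mem_span_range_iff_exists_fun]
  constructor
  · rintro ⟨c, hc⟩ i hi
    simp only [smul_smul] at hc
    rw [← hb.coeffs_ext (g := fun i => c i * logFactor α b i) hc i, logFactor_of_mem hi]
    exact dvd_mul_left _ _
  · intro h
    have h' : ∀ i, ∃ c, c * logFactor α b i = g i := fun i => by
      by_cases hi : i ∈ nonLogIndices α b
      · obtain ⟨c, hc⟩ := h i hi
        exact ⟨c, by rw [logFactor_of_mem hi, hc, mul_comm]⟩
      · exact ⟨g i, by rw [logFactor_of_notMem hi, mul_one]⟩
    choose c hc using h'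
    exact ⟨c, Finset.sum_congr rfl fun i _ => by rw [smul_smul, hc]⟩

namespace IsReducedBasis

variable {α : Module.Dual K (Fin ℓ → K)} {L M : Submodule (CoordRing K ℓ) (Der K ℓ)}
  {b : Fin ℓ → Der K ℓ} {d : Fin ℓ → ℕ}

/-- The multiples `logFactor α b i • b i` are part of a minimal system of generators of the
submodule `M` of the members of `L` that are logarithmic along `α = 0`. The coordinates of a
member of `M` at the non-logarithmic indices lie in `𝔪`, hence those of a member of `𝔪 M` lie in
`𝔪²`, which contains no non-zero multiple of `α` by a constant. -/
theorem eq_zero_of_sum_logFactor_smul_eq (hb : IsReducedBasis α L b d) (hα : α ≠ 0)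
    (hM : ∀ θ, θ ∈ M ↔ θ ∈ L ∧ linPoly α ∣ θ (linPoly α)) {J : Type*} [Fintype J]
    {G : J → Der K ℓ} (hG : ∀ j, G j ∈ M) (c : Fin ℓ → K) (q : J → CoordRing K ℓ)
    (hq : ∀ j, constantCoeff (q j) = 0)
    (h : ∑ i, (C (c i) : CoordRing K ℓ) • logFactor α b i • b i = ∑ j, q j • G j) (i : Fin ℓ) :
    c i = 0 := by
  choose x hx using fun j => hb.exists_coeffs ((hM _).mp (hG j)).1
  have hcoef : C (c i) * logFactor α b i = ∑ j, q j * x j i := by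
    refine hb.coeffs_ext (g := fun i => C (c i) * logFactor α b i)
      (h := fun i => ∑ j, q j * x j i) ?_ i
    simp only [← hx] at h
    simp only [mul_smul, h, Finset.sum_smul, Finset.smul_sum]
    exact Finset.sum_comm
  by_cases hi : i ∈ nonLogIndices α b
  · rw [logFactor_of_mem hi] at hcoef
    have h1 := congrArg (homogeneousComponent 1) hcoef
    rw [homogeneousComponent_C_mul, homogeneousComponent_of_mem (linPoly_isHomogeneous α),
      if_pos rfl, map_sum, Finset.sum_eq_zero fun j _ => homogeneousComponent_one_mul_eq_zero
        (hq j) (hb.constantCoeff_eq_zero (by rw [hx]; exact ((hM _).mp (hG j)).2) hi)] at h1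
    simpa [linPoly_ne_zero hα] using h1
  · rw [logFactor_of_notMem hi] at hcoef
    simpa [hq] using congrArg constantCoeff hcoef

/-- If `M` has `ℓ + 1` minimal generators, then a single homogeneous derivation generates it
together with the multiples `logFactor α b i • b i`. -/
theorem exists_level (hb : IsReducedBasis α L b d) (hα : α ≠ 0)
    (hM : ∀ θ, θ ∈ M ↔ θ ∈ L ∧ linPoly α ∣ θ (linPoly α)) {J : Type*} [Fintype J]
    {G : J → Der K ℓ} {δ : J → ℕ} (hG : ∀ j, DerHomogeneous (G j) (δ j))
    (hcard : Fintype.card J = ℓ + 1)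
    (hmin : ∀ p : J → CoordRing K ℓ, ∑ j, p j • G j = 0 → ∀ j, constantCoeff (p j) = 0)
    (hspan : Submodule.span (CoordRing K ℓ) (Set.range G) = M) :
    ∃ (g : Fin ℓ → CoordRing K ℓ) (e : ℕ), DerHomogeneous (∑ i, g i • b i) e ∧
      (∀ i ∉ nonLogIndices α b, g i = 0) ∧ (∃ i ∈ nonLogIndices α b, ¬ linPoly α ∣ g i) ∧
      M = Submodule.span (CoordRing K ℓ) (Set.range fun i => logFactor α b i • b i) ⊔
        Submodule.span (CoordRing K ℓ) {∑ i, g i • b i} := by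
  classical
  have hGM : ∀ j, G j ∈ M := fun j => hspan ▸ Submodule.subset_span ⟨j, rfl⟩
  have hNM : ∀ i, logFactor α b i • b i ∈ M := fun i => by
    refine (hM _).mpr ⟨Submodule.smul_mem _ _ (hb.mem i), ?_⟩
    rw [Derivation.smul_apply, smul_eq_mul]
    by_cases hi : i ∈ nonLogIndices α b
    · rw [logFactor_of_mem hi]
      exact dvd_mul_right _ _
    · rw [mem_nonLogIndices, not_not] at hi
      exact hi.mul_left _
  obtain ⟨j, hj, hsup⟩ := exists_generator_completing
    (fun i => (hb.homogeneous i).smul (logFactor_isHomogeneous α b i)) hG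
    (by simp [hcard]) hmin (fun i => hspan ▸ hNM i)
    (fun c q hq h i => hb.eq_zero_of_sum_logFactor_smul_eq hα hM hGM c q hq h i)
  rw [hspan] at hsup
  obtain ⟨h, hh⟩ := hb.exists_coeffs ((hM _).mp (hGM j)).1
  rw [← hh] at hj hsup
  -- The coordinates of the generator at the logarithmic indices may be removed.
  let g : Fin ℓ → CoordRing K ℓ := fun i => if i ∈ nonLogIndices α b then h i else 0
  have hdiff : ∑ i, h i • b i - ∑ i, g i • b i ∈ Submodule.span (CoordRing K ℓ)
      (Set.range fun i => logFactor α b i • b i) := by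
    have hsub : ∑ i, h i • b i - ∑ i, g i • b i = ∑ i, (h i - g i) • b i := by
      rw [← Finset.sum_sub_distrib]
      exact Finset.sum_congr rfl fun i _ => (sub_smul _ _ _).symm
    rw [hsub, hb.sum_smul_mem_span_logFactor_smul_iff]
    intro i hi
    simp [g, hi]
  refine ⟨g, δ j, ?_, fun i hi => if_neg hi, ?_, ?_⟩
  · have hself : derComp (δ j) (∑ i, g i • b i) = ∑ i, g i • b i := by
      rw [derComp_sum_smul g hb.homogeneous]
      refine Finset.sum_congr rfl fun i _ => ?_
      by_cases hi : i ∈ nonLogIndices α b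
      · simp only [g, if_pos hi]
        rw [hb.shiftComp_coeff (hh ▸ hG j)]
      · simp [g, hi, shiftComp]
    exact hself ▸ derHomogeneous_derComp _ _
  · rw [hb.sum_smul_mem_span_logFactor_smul_iff] at hj
    push Not at hj
    obtain ⟨i, hi, hdvd⟩ := hj
    exact ⟨i, hi, by simpa [g, hi] using hdvd⟩
  · rw [hsup]
    refine le_antisymm (sup_le le_sup_left ?_) (sup_le le_sup_left ?_) <;>
      rw [Submodule.span_singleton_le_iff_mem]
    · rw [← sub_add_cancel (∑ i, h i • b i) (∑ i, g i • b i)]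
      exact add_mem (Submodule.mem_sup_left hdiff)
        (Submodule.mem_sup_right (Submodule.mem_span_singleton_self _))
    · rw [← sub_sub_cancel (∑ i, h i • b i) (∑ i, g i • b i)]
      exact sub_mem (Submodule.mem_sup_right (Submodule.mem_span_singleton_self _))
        (Submodule.mem_sup_left hdiff)

/-- The Koszul relation between the values at `α` of two members of a basis. -/
theorem exists_koszul (α : Module.Dual K (Fin ℓ → K)) (b : Fin ℓ → Der K ℓ) {i j : Fin ℓ}
    (hij : i ≠ j) : ∃ u : Fin ℓ → CoordRing K ℓ, u i = b j (linPoly α) ∧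
      (∀ k, k ≠ i → k ≠ j → u k = 0) ∧ (∑ k, u k • b k) (linPoly α) = 0 := by
  refine ⟨Pi.single i (b j (linPoly α)) - Pi.single j (b i (linPoly α)), by simp [hij],
    fun k hi hj => by simp [hi, hj], ?_⟩
  rw [sum_smul_der_apply]
  simp only [Pi.sub_apply, sub_mul, Finset.sum_sub_distrib, Pi.single_apply, ite_mul, zero_mul,
    Finset.sum_ite_eq', Finset.mem_univ, if_true]
  ring

/-- The syzygies modulo `α` between the values `b i (α)` that are not divisible by `α` form a
module of rank one less than their number. As they are generated by the single syzygy given by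
the level element, there are exactly two such values. -/
theorem card_nonLogIndices_eq_two (hb : IsReducedBasis α L b d) (hα : α ≠ 0)
    (hM : ∀ θ, θ ∈ M ↔ θ ∈ L ∧ linPoly α ∣ θ (linPoly α)) {g : Fin ℓ → CoordRing K ℓ}
    (hg : ∃ i ∈ nonLogIndices α b, ¬ linPoly α ∣ g i)
    (hspan : M = Submodule.span (CoordRing K ℓ) (Set.range fun i => logFactor α b i • b i) ⊔
        Submodule.span (CoordRing K ℓ) {∑ i, g i • b i}) :
    (nonLogIndices α b).card = 2 := by
  classical
  have hp := linPoly_prime hα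
  have hφM : ∑ i, g i • b i ∈ M :=
    hspan ▸ Submodule.mem_sup_right (Submodule.mem_span_singleton_self _)
  obtain ⟨k, hk, hgk⟩ := hg
  refine le_antisymm ?_ ?_
  · by_contra! hlt
    have hlt' : 1 < ((nonLogIndices α b).erase k).card := by
      rw [Finset.card_erase_of_mem hk]
      omega
    obtain ⟨i, hi, j, hj, hij⟩ := Finset.one_lt_card.mp hlt'
    rw [Finset.mem_erase] at hi hj
    obtain ⟨u, hui, huk, hu⟩ := exists_koszul α b hij
    have huM : ∑ l, u l • b l ∈ M := (hM _).mpr ⟨hb.sum_mem u, hu ▸ dvd_zero _⟩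
    rw [hspan, Submodule.mem_sup] at huM
    obtain ⟨n, hn, y, hy, hny⟩ := huM
    obtain ⟨z, rfl⟩ := Submodule.mem_span_singleton.mp hy
    have hn' : n = ∑ l, (u l - z * g l) • b l := by
      rw [eq_sub_of_add_eq hny, Finset.smul_sum, ← Finset.sum_sub_distrib]
      exact Finset.sum_congr rfl fun l _ => by
        rw [smul_smul]
        exact (sub_smul _ _ _).symm
    rw [hn', hb.sum_smul_mem_span_logFactor_smul_iff] at hn
    have hk' := hn k hk
    rw [huk k hi.1.symm hj.1.symm, zero_sub, dvd_neg] at hk'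
    refine mem_nonLogIndices.mp hj.2 ?_
    have hz := (hp.dvd_or_dvd hk').resolve_right hgk
    rw [← hui]
    simpa using (hn i hi.2).add (hz.mul_right (g i))
  · by_contra! hlt
    have hone : ∀ j, j ≠ k → linPoly α ∣ b j (linPoly α) := fun j hj => by
      by_contra hc
      exact hj (Finset.card_le_one.mp (by omega) j (mem_nonLogIndices.mpr hc) k hk)
    have h := ((hM _).mp hφM).2
    rw [sum_smul_der_apply, ← Finset.add_sum_erase _ _ (Finset.mem_univ k)] at h
    have h' := (dvd_add_left (Finset.dvd_sum fun j hj =>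
      (hone j (Finset.ne_of_mem_erase hj)).mul_left (g j))).mp h
    exact (hp.dvd_or_dvd h').elim hgk (mem_nonLogIndices.mp hk)

theorem constantCoeff_apply_linPoly (hb : IsReducedBasis α L b d)
    (hcard : 1 < (nonLogIndices α b).card) (j : Fin ℓ) :
    constantCoeff (b j (linPoly α)) = 0 := by
  by_cases hj : j ∈ nonLogIndices α b
  · obtain ⟨i, hi, hij⟩ := Finset.exists_mem_ne hcard j
    obtain ⟨u, hui, -, hu⟩ := exists_koszul α b hij
    rw [← hui]
    exact hb.constantCoeff_eq_zero (hu ▸ dvd_zero _) hi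
  · rw [mem_nonLogIndices, not_not] at hj
    obtain ⟨q, hq⟩ := hj
    rw [hq, map_mul, constantCoeff_linPoly, zero_mul]

end IsReducedBasis

end LevelElement

/-! ### Arrangements, their resolutions, and the Euler derivation -/

theorem Module.Basis.linearIndependent_subtype {ι R M : Type*} [CommRing R] [AddCommGroup M]
    [Module R M] {N : Submodule R M} (b : Module.Basis ι R N) :
    LinearIndependent R (N.subtype ∘ b) :=
  b.linearIndependent.map' N.subtype (Submodule.ker_subtype _)

namespace HypArrangement

variable {K : Type*} [Field K] {ℓ : ℕ}

theorem genMap_apply (θ : Fin ℓ → Der K ℓ) (φ : Der K ℓ)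
    (x : (Fin ℓ → CoordRing K ℓ) × CoordRing K ℓ) :
    genMap θ φ x = ∑ i, x.1 i • θ i + x.2 • φ := by
  simp [genMap, Fintype.linearCombination_apply]

theorem range_genMap (θ : Fin ℓ → Der K ℓ) (φ : Der K ℓ) :
    LinearMap.range (genMap θ φ) = Submodule.span (CoordRing K ℓ) (Set.range θ) ⊔
      Submodule.span (CoordRing K ℓ) {φ} := by
  rw [genMap, LinearMap.range_coprod, Fintype.range_linearCombination,
    LinearMap.range_toSpanSingleton]

/-- A plus-one generated arrangement has `ℓ + 1` minimal homogeneous generators: the coefficients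
of a relation between them have no constant term. -/
theorem IsSPOG.exists_minimal_generators [NeZero ℓ] {A : HypArrangement K ℓ} (hA : A.IsSPOG) :
    ∃ (G : Option (Fin ℓ) → Der K ℓ) (δ : Option (Fin ℓ) → ℕ),
      (∀ j, DerHomogeneous (G j) (δ j)) ∧
      (∀ p : Option (Fin ℓ) → CoordRing K ℓ,
        ∑ j, p j • G j = 0 → ∀ j, constantCoeff (p j) = 0) ∧
      Submodule.span (CoordRing K ℓ) (Set.range G) = A.logDer := by
  obtain ⟨d, e, -, θ, φ, ι, h⟩ := hA
  refine ⟨fun o => o.elim φ θ, fun o => o.elim e d, ?_, fun p hp => ?_, ?_⟩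
  · rintro (_ | i)
    exacts [h.homogeneous_level, h.homogeneous_gen i]
  · have h0 : genMap θ φ (fun i => p (some i), p none) = 0 := by
      rw [genMap_apply, ← hp, Fintype.sum_option, add_comm]
      rfl
    obtain ⟨q, hq⟩ := (h.exact _).mp h0
    rintro (_ | i)
    · have := h.minimal_level q
      rwa [hq] at this
    · have := h.minimal q i
      rwa [hq] at this
  · rw [← h.range_eq, range_genMap]
    apply le_antisymm
    · rw [Submodule.span_le]
      rintro _ ⟨_ | i, rfl⟩
      · exact Submodule.mem_sup_right (Submodule.mem_span_singleton_self _)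
      · exact Submodule.mem_sup_left (Submodule.subset_span ⟨i, rfl⟩)
    · refine sup_le (Submodule.span_mono ?_) (Submodule.span_mono ?_)
      · rintro _ ⟨i, rfl⟩
        exact ⟨some i, rfl⟩
      · rw [Set.singleton_subset_iff]
        exact ⟨none, rfl⟩

theorem IsFree.exists_isHomogeneousBasis {A : HypArrangement K ℓ} (hA : A.IsFree) :
    ∃ b d, IsHomogeneousBasis A.logDer b d := by
  obtain ⟨d, b, hd⟩ := hA
  refine ⟨A.logDer.subtype ∘ b, d, b.linearIndependent_subtype, ?_, hd⟩
  rw [Set.range_comp, Submodule.span_image, b.span_eq, Submodule.map_top, Submodule.range_subtype]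

/-- The Euler derivation is not in `𝔪 D(A)` for a non-empty arrangement: if `β` defines a
hyperplane of `A`, then it takes the value `β` at `β`, while all values at `β` of members of
`D(A)` are multiples of `β`. -/
theorem exists_constantCoeff_ne_zero_of_sum_eq_eulerDer {A : HypArrangement K ℓ}
    (hA : A.hyperplanes.Nonempty) {b : Fin ℓ → Der K ℓ} (hb : ∀ i, b i ∈ A.logDer)
    {p : Fin ℓ → CoordRing K ℓ} (hp : ∑ i, p i • b i = eulerDer K ℓ) :
    ∃ i, constantCoeff (p i) ≠ 0 := by
  by_contra! hc
  obtain ⟨H, hH⟩ := hA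
  obtain ⟨β, hβ⟩ := A.isHyperplane H hH
  choose q hq using fun i => hb i H hH β hβ
  have h := congrArg (fun θ : Der K ℓ => θ (linPoly β)) hp
  simp only [sum_smul_der_apply, hq, eulerDer_linPoly] at h
  have h1 : ∑ i, p i * q i = 1 := by
    refine mul_left_cancel₀ (linPoly_ne_zero hβ.1) ?_
    rw [mul_one, Finset.mul_sum]
    exact (Finset.sum_congr rfl fun i _ => by ring).trans h
  simpa [hc] using congrArg constantCoeff h1

/-- If the values at `α` of a generating system of `D(A)` have no constant term, then `A` is not
empty, since `D(A) = Der S` for the empty arrangement. -/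
theorem hyperplanes_nonempty_of_constantCoeff_eq_zero {A : HypArrangement K ℓ}
    {b : Fin ℓ → Der K ℓ} {d : Fin ℓ → ℕ} (hb : IsHomogeneousBasis A.logDer b d)
    {α : Module.Dual K (Fin ℓ → K)} (hα : α ≠ 0)
    (h : ∀ i, constantCoeff (b i (linPoly α)) = 0) : A.hyperplanes.Nonempty := by
  rw [Set.nonempty_iff_ne_empty]
  intro hempty
  obtain ⟨i, hi⟩ := exists_single_ne_zero hα
  let D : Der K ℓ := mkDerivation K (Pi.single i 1)
  have hD : D ∈ A.logDer := fun L hL => absurd hL (by simp [hempty])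
  have hval : D (linPoly α) = C (α (Pi.single i 1)) := by
    simp [D, linPoly, mkDerivation_X, Pi.single_apply]
  obtain ⟨g, hg⟩ := hb.exists_coeffs hD
  rw [← hg, sum_smul_der_apply] at hval
  have := congrArg constantCoeff hval
  simp only [map_sum, map_mul, h, mul_zero, Finset.sum_const_zero, constantCoeff_C] at this
  exact hi this.symm

/-- The minimal free resolution of `D(A)` obtained from a reduced basis `b` of `D(A \ {H})` and a
level element `∑ g i • b i`. Its only relation comes from `α (∑ g i b i) = ∑ g i (α b i)`, where
`i` runs over the non-logarithmic indices. -/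
theorem isSPOGResolution_of_isReducedBasis {A : HypArrangement K ℓ}
    {α : Module.Dual K (Fin ℓ → K)} (hα : α ≠ 0) {L : Submodule (CoordRing K ℓ) (Der K ℓ)}
    (hM : ∀ θ, θ ∈ A.logDer ↔ θ ∈ L ∧ linPoly α ∣ θ (linPoly α)) {b : Fin ℓ → Der K ℓ}
    {d : Fin ℓ → ℕ} (hb : IsReducedBasis α L b d) {g : Fin ℓ → CoordRing K ℓ} {e : ℕ}
    (he : DerHomogeneous (∑ i, g i • b i) e) (hg0 : ∀ i ∉ nonLogIndices α b, g i = 0)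
    (hg : ∃ i ∈ nonLogIndices α b, ¬ linPoly α ∣ g i)
    (hspan : A.logDer = Submodule.span (CoordRing K ℓ)
        (Set.range fun i => logFactor α b i • b i) ⊔
        Submodule.span (CoordRing K ℓ) {∑ i, g i • b i}) :
    A.IsSPOGResolution (fun i => d i + if i ∈ nonLogIndices α b then 1 else 0) e
      (fun i => logFactor α b i • b i) (∑ i, g i • b i)
      (LinearMap.toSpanSingleton (CoordRing K ℓ) _ (fun i => -g i, linPoly α)) := by
  have hp := linPoly_prime hα
  have hgen : ∀ x : (Fin ℓ → CoordRing K ℓ) × CoordRing K ℓ,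
      genMap (fun i => logFactor α b i • b i) (∑ i, g i • b i) x =
        ∑ i, (x.1 i * logFactor α b i + x.2 * g i) • b i := fun x => by
    simp only [genMap_apply, smul_smul, Finset.smul_sum, add_smul, Finset.sum_add_distrib]
  refine ⟨fun i => ?_, he, fun i => ?_, ?_, ?_, ?_, ?_, ?_, ?_⟩
  · convert (hb.homogeneous i).smul (logFactor_isHomogeneous α b i)
  · simp only [LinearMap.toSpanSingleton_apply, one_smul]
    by_cases hi : i ∈ nonLogIndices α b
    · rw [if_pos hi]
      have h := shiftComp_isShiftHomogeneous (g i) (d i) e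
      rw [hb.shiftComp_coeff he] at h
      rcases h with h | ⟨k, hk, hhom⟩
      · exact Or.inl (by rw [h, neg_zero])
      · exact Or.inr ⟨k, by omega, hhom.neg⟩
    · exact Or.inl (by rw [hg0 i hi, neg_zero])
  · simp only [LinearMap.toSpanSingleton_apply, one_smul]
    exact Or.inr ⟨1, by omega, linPoly_isHomogeneous α⟩
  · intro p q hpq
    simp only [LinearMap.toSpanSingleton_apply] at hpq
    exact mul_right_cancel₀ hp.ne_zero (congrArg Prod.snd hpq)
  · rintro ⟨x, z⟩
    rw [hgen]
    constructor
    · intro h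
      have hrel := Fintype.linearIndependent_iff.mp hb.linearIndependent _ h
      obtain ⟨k, hk, hgk⟩ := hg
      have hz : linPoly α ∣ z := by
        have h1 := hrel k
        rw [logFactor_of_mem hk] at h1
        refine (hp.dvd_or_dvd ?_).resolve_right hgk
        exact (dvd_add_right (dvd_mul_left (linPoly α) (x k))).mp (h1 ▸ dvd_zero _)
      obtain ⟨q, rfl⟩ := hz
      refine ⟨q, Prod.ext (funext fun i => ?_) (mul_comm _ _)⟩
      change q * -g i = x i
      have h1 := hrel i
      by_cases hi : i ∈ nonLogIndices α b
      · rw [logFactor_of_mem hi] at h1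
        refine mul_left_cancel₀ hp.ne_zero ?_
        linear_combination -h1
      · rw [logFactor_of_notMem hi, hg0 i hi] at h1
        rw [hg0 i hi]
        linear_combination -h1
    · rintro ⟨q, hq⟩
      have h1 : x = fun i => q * -g i := (congrArg Prod.fst hq).symm
      have h2 : z = q * linPoly α := (congrArg Prod.snd hq).symm
      refine Finset.sum_eq_zero fun i _ => ?_
      have h3 : x i * logFactor α b i + z * g i = 0 := by
        simp only [h1, h2]
        by_cases hi : i ∈ nonLogIndices α b
        · rw [logFactor_of_mem hi]
          ring
        · rw [hg0 i hi]
          ring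
      simp only [h3, zero_smul]
  · rw [range_genMap, hspan]
  · intro q i
    change constantCoeff (q * -g i) = 0
    by_cases hi : i ∈ nonLogIndices α b
    · have h : ∑ i, g i • b i ∈ A.logDer :=
        hspan ▸ Submodule.mem_sup_right (Submodule.mem_span_singleton_self _)
      rw [map_mul, map_neg, hb.constantCoeff_eq_zero ((hM _).mp h).2 hi, neg_zero, mul_zero]
    · rw [hg0 i hi, neg_zero, mul_zero, map_zero]
  · intro q
    change constantCoeff (q * linPoly α) = 0
    rw [map_mul, constantCoeff_linPoly, mul_zero]

/-- A reduced basis of a non-empty arrangement can be chosen to begin with `θ_E`. -/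
theorem exists_isReducedBasis_eulerDer [NeZero ℓ] {A : HypArrangement K ℓ}
    (hA : A.hyperplanes.Nonempty) {α : Module.Dual K (Fin ℓ → K)} {b : Fin ℓ → Der K ℓ}
    {d : Fin ℓ → ℕ} (hb : IsReducedBasis α A.logDer b d) :
    ∃ b' d', IsReducedBasis α A.logDer b' d' ∧ b' 0 = eulerDer K ℓ ∧ d' 0 = 1 := by
  obtain ⟨p, hp⟩ := hb.exists_coeffs A.eulerDer_mem_logDer
  obtain ⟨i, hi⟩ := exists_constantCoeff_ne_zero_of_sum_eq_eulerDer hA hb.mem hp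
  have hhom : DerHomogeneous (∑ j, p j • b j) 1 := hp ▸ derHomogeneous_eulerDer
  have hs := hb.shiftComp_coeff hhom i
  have hu : IsUnit (p i) := hs ▸ isUnit_shiftComp (hs.symm ▸ hi)
  have hdvd : linPoly α ∣ (∑ j, p j • b j) (linPoly α) := by rw [hp, eulerDer_linPoly]
  refine ⟨_, _, (hb.update hu hhom hdvd).reindex (Equiv.swap 0 i), ?_, ?_⟩
  · simp [hp]
  · simp

end HypArrangement

open HypArrangement in
theorem proposition3p8 {K : Type*} [Field K] {ℓ : ℕ} [NeZero ℓ]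
    (A : HypArrangement K ℓ) (hA : A.IsSPOG)
    (H : Submodule K (Fin ℓ → K)) (hH : H ∈ A.hyperplanes)
    (α : Module.Dual K (Fin ℓ → K)) (hα : Defines α H)
    (hfree : (A.delete H).IsFree) :
    ∃ (d : Fin ℓ → ℕ) (e : ℕ) (θ : Fin ℓ → Der K ℓ) (φ : Der K ℓ) (s t : Fin ℓ),
      A.IsSPOGGenerators d e θ φ ∧ 0 < s ∧ s < t ∧
      ∃ b : Module.Basis (Fin ℓ) (CoordRing K ℓ) (A.delete H).logDer,
        linPoly α • (b s : Der K ℓ) = θ s ∧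
        linPoly α • (b t : Der K ℓ) = θ t ∧
        ∀ i, i ≠ s → i ≠ t → (b i : Der K ℓ) = θ i := by
  obtain ⟨G, δ, hG, hmin, hspan⟩ := hA.exists_minimal_generators
  have hM := A.mem_logDer_iff_delete hH hα
  have hlevel := fun {b d} (hb : IsReducedBasis α (A.delete H).logDer b d) =>
    hb.exists_level hα.1 hM hG (by simp) hmin hspan
  obtain ⟨b₀, d₀, hb₀⟩ := hfree.exists_isHomogeneousBasis
  obtain ⟨b₁, d₁, hb₁⟩ := hb₀.exists_isReducedBasis α
  obtain ⟨g₁, -, -, -, hg₁, hspan₁⟩ := hlevel hb₁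
  have hcard₁ := hb₁.card_nonLogIndices_eq_two hα.1 hM hg₁ hspan₁
  have hne := hyperplanes_nonempty_of_constantCoeff_eq_zero hb₁.toIsHomogeneousBasis hα.1
    (hb₁.constantCoeff_apply_linPoly (by omega))
  obtain ⟨b, d, hb, hb0, hd0⟩ := exists_isReducedBasis_eulerDer hne hb₁
  obtain ⟨g, e, he, hg0, hg, hspan'⟩ := hlevel hb
  have hcard := hb.card_nonLogIndices_eq_two hα.1 hM hg hspan'
  have h0 : (0 : Fin ℓ) ∉ nonLogIndices α b := by
    rw [mem_nonLogIndices, not_not, hb0, eulerDer_linPoly]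
  obtain ⟨s, t, hst, hT⟩ : ∃ s t, s < t ∧ nonLogIndices α b = {s, t} := by
    obtain ⟨x, y, hxy, hT⟩ := Finset.card_eq_two.mp hcard
    rcases lt_or_gt_of_ne hxy with h | h
    exacts [⟨x, y, h, hT⟩, ⟨y, x, h, by rw [hT, Finset.pair_comm]⟩]
  have hs : s ∈ nonLogIndices α b := by simp [hT]
  have ht : t ∈ nonLogIndices α b := by simp [hT]
  let B : Module.Basis (Fin ℓ) (CoordRing K ℓ) (A.delete H).logDer :=
    (Module.Basis.span hb.linearIndependent).map (LinearEquiv.ofEq _ _ hb.span_eq)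
  have hB : ∀ i, (B i : Der K ℓ) = b i := fun i => by
    simp [B, Module.Basis.span_apply]
  refine ⟨_, e, _, _, s, t, ⟨?_, ?_, _, isSPOGResolution_of_isReducedBasis hα.1 hM hb he hg0 hg
    hspan'⟩, Fin.pos_iff_ne_zero.mpr fun h => h0 (h ▸ hs), hst, B, ?_, ?_, fun i his hit => ?_⟩
  · simp [h0, hd0]
  · simp only [logFactor_of_notMem h0, one_smul, hb0]
  · simp only [hB, logFactor_of_mem hs]
  · simp only [hB, logFactor_of_mem ht]
  · have hi : i ∉ nonLogIndices α b := by simp [hT, his, hit]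
    simp only [hB, logFactor_of_notMem hi, one_smul]
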